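/- Let $R$ be a valuation domain with maximal ideal $P$ (fields are allowed). Assume that there is a finite strictly decreasing family of prime ideals $$P=L_0\supset L_1\supset\dots\supset L_{m-1}\supset L_m=0\qquad(m\ge 0)$$ such that the valuation domain $R_{L_k}/L_{k+1}$ is almost maximal for every $k$ with $0\le k\le m-1$ (here $L_{k+1}$ is identified with $L_{k+1}R_{L_k}$). Let $G$ be a torsion-free $R$-module of finite rank. Then $G$ has a pure-composition series $$0=G_0\subseteq G_1\subseteq\dots\subseteq G_m\subseteq G_{m+1}=G,$$ that is, an increasing chain of pure submodules of $G$, such that for every $j$ with $0\le j\le m$ the factor $G_{j+1}/G_j$ is isomorphic to a finite direct sum of ideals of $R_{L_j}$. Here a valuation domain $S$ is called almost maximal if every finitely solvable system of congruences $x\equiv a_i \pmod{I_i}$ $(i\in\Lambda)$, with $a_i\in S$ and ideals $I_i$ of $S$ such that $\bigcap_{i\in\Lambda} I_i\ne 0$, has a solution in $S$. A submodule $N$ of a module $M$ is pure if every finite system of linear equations with coefficients in $R$ and right-hand sides in $N$ that has a solution in $M$ has a solution in $N$. -/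

import Mathlib

open scoped DirectSum Cardinal

universe u

/-- A submodule `N` of `M` is pure if every finite system of linear equations with
right-hand sides in `N` that is solvable in `M` is solvable in `N`. -/
def Submodule.IsPureIn {R : Type*} {M : Type*} [CommRing R] [AddCommGroup M] [Module R M]
    (N : Submodule R M) : Prop :=
  ∀ (p q : ℕ) (r : Matrix (Fin p) (Fin q) R) (b : Fin p → M), (∀ i, b i ∈ N) →
    (∃ x : Fin q → M, ∀ i, ∑ k, r i k • x k = b i) →
    ∃ y : Fin q → M, (∀ k, y k ∈ N) ∧ ∀ i, ∑ k, r i k • y k = b i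

/-- A commutative ring (in practice a valuation domain) is almost maximal if every finitely
solvable system of congruences `x ≡ a i mod I i` with `⋂ I i ≠ 0` is solvable. Equivalently,
`S ⧸ A` is linearly compact in the discrete topology for every nonzero ideal `A`.
Index types in the universe of `S` suffice, since a system is determined by its set of
pairs `(I i, a i)`. -/
def IsAlmostMaximal (S : Type u) [CommRing S] : Prop :=
  ∀ (ι : Type u) (I : ι → Ideal S) (a : ι → S), (⨅ i, I i) ≠ ⊥ →
    (∀ s : Finset ι, ∃ x : S, ∀ i ∈ s, x - a i ∈ I i) →
    ∃ x : S, ∀ i, x - a i ∈ I i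

/-- `F 0 ⊆ F 1 ⊆ ⋯ ⊆ F n` is an increasing chain of pure submodules of `M` running from `0`
to `M`. -/
structure IsPureSeries {R : Type*} {M : Type*} [CommRing R] [AddCommGroup M] [Module R M]
    {n : ℕ} (F : Fin (n + 1) → Submodule R M) : Prop where
  bot : F 0 = ⊥
  top : F (Fin.last n) = ⊤
  mono : Monotone F
  pure : ∀ j, (F j).IsPureIn

/-! Saturating the spans of initial segments of a finite maximal independent set filters `G` with
factors `B ⧸ A` that are torsion-free and, over a valuation domain, uniserial. Such a factor has
index `j` when every element outside `L j` divides it and, for `j` not last, some element outside `L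
(j + 1)` does not. Climbing the family `L` shows that an index always exists.

The theorem then amounts to sorting: if a factor of index `k` lies below one of index `l ≤ k`, the
extension splits (`RankOneStep.exists_complement`). For this it suffices to find `x₀` in the upper
factor such that every division `x₀ ≡ r v` modulo `B` lifts modulo `A`. If `l < k`, take `v₀` not
divisible by some `s ∉ L (l + 1)`; each such `r` divides `s`, so `r ∉ L k` and the lower factor is
`r`-divisible. If `l = k` is last, any `x₀` outside `B` works, as `r ≠ 0`. If `l = k` is not last,
correcting `v₀` by an element of `B` is a system of congruences in an ideal, which almost maximality
solves.

Each new factor of index `l` therefore slides down past all factors of index at least `l`. Inside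
one index the same splitting gives a direct sum, and each summand is an ideal of the localization by
taking coordinates with respect to one element. Purity follows from the torsion-free quotients. -/

namespace TorsionFreeSeries

/-! ### Rank-one steps, transport and complements -/

section Steps

variable {R : Type u} [CommRing R] {G : Type*} [AddCommGroup G] [Module R G] {m : ℕ}

/-- `B ⧸ A` is a torsion-free uniserial `R`-module on which every element outside `L j` acts
surjectively, while, if `j` is not the last index, some element outside `L (j + 1)` does not. -/
structure RankOneStep (L : Fin (m + 1) → Ideal R) (j : Fin (m + 1)) (A B : Submodule R G) :
    Prop where
  le : A ≤ B
  sat : ∀ r : R, r ≠ 0 → ∀ b ∈ B, r • b ∈ A → b ∈ A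
  uniserial : ∀ x ∈ B, ∀ y ∈ B, ∃ r : R, x - r • y ∈ A ∨ y - r • x ∈ A
  div : ∀ s ∉ L j, ∀ b ∈ B, ∃ b' ∈ B, b - s • b' ∈ A
  nondiv : ∀ k : Fin m, k.castSucc = j → ∃ s ∉ L k.succ, ∃ b ∈ B, ∀ b' ∈ B, b - s • b' ∉ A

variable {L : Fin (m + 1) → Ideal R} {j k l : Fin (m + 1)} {A B C D : Submodule R G}

/-- The second isomorphism theorem: the defining properties depend only on the factor, and `B ⧸ (B ⊓
C) ≅ (B ⊔ C) ⧸ C`. `RankOneStep.inf` is the converse transport. -/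
theorem RankOneStep.sup (h : RankOneStep L j (B ⊓ C) B) : RankOneStep L j C (B ⊔ C) := by
  have key : ∀ x ∈ B ⊔ C, ∃ b ∈ B, x - b ∈ C := by
    intro x hx
    obtain ⟨b, hb, c, hc, rfl⟩ := Submodule.mem_sup.1 hx
    exact ⟨b, hb, by simpa using hc⟩
  have lift : ∀ b ∈ B, b ∈ B ⊔ C := fun b hb => Submodule.mem_sup_left hb
  refine ⟨le_sup_right, ?_, ?_, ?_, ?_⟩
  · intro r hr x hx hrx
    obtain ⟨b, hb, hxb⟩ := key x hx
    have h1 : r • b ∈ C := by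
      have := C.sub_mem hrx (C.smul_mem r hxb)
      rwa [show r • x - r • (x - b) = r • b by module] at this
    have h2 := (h.sat r hr b hb ⟨B.smul_mem r hb, h1⟩).2
    simpa using C.add_mem hxb h2
  · intro x hx y hy
    obtain ⟨b, hb, hxb⟩ := key x hx
    obtain ⟨c, hc, hyc⟩ := key y hy
    obtain ⟨r, hr | hr⟩ := h.uniserial b hb c hc
    · refine ⟨r, Or.inl ?_⟩
      have := C.sub_mem (C.add_mem hxb hr.2) (C.smul_mem r hyc)
      rwa [show x - b + (b - r • c) - r • (y - c) = x - r • y by module] at this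
    · refine ⟨r, Or.inr ?_⟩
      have := C.sub_mem (C.add_mem hyc hr.2) (C.smul_mem r hxb)
      rwa [show y - c + (c - r • b) - r • (x - b) = y - r • x by module] at this
  · intro s hs x hx
    obtain ⟨b, hb, hxb⟩ := key x hx
    obtain ⟨b', hb', hbb⟩ := h.div s hs b hb
    refine ⟨b', lift _ hb', ?_⟩
    have := C.add_mem hxb hbb.2
    rwa [show x - b + (b - s • b') = x - s • b' by module] at this
  · intro i hi
    obtain ⟨s, hs, b, hb, hbs⟩ := h.nondiv i hi
    refine ⟨s, hs, b, lift _ hb, fun x hx hC => ?_⟩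
    obtain ⟨b', hb', hxb⟩ := key x hx
    refine hbs b' hb' ⟨B.sub_mem hb (B.smul_mem s hb'), ?_⟩
    have := C.add_mem hC (C.smul_mem s hxb)
    rwa [show b - s • x + s • (x - b') = b - s • b' by module] at this

theorem RankOneStep.inf (h : RankOneStep L j C (B ⊔ C)) : RankOneStep L j (B ⊓ C) B := by
  have key : ∀ x ∈ B ⊔ C, ∃ b ∈ B, x - b ∈ C := by
    intro x hx
    obtain ⟨b, hb, c, hc, rfl⟩ := Submodule.mem_sup.1 hx
    exact ⟨b, hb, by simpa using hc⟩
  have lift : ∀ b ∈ B, b ∈ B ⊔ C := fun b hb => Submodule.mem_sup_left hb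
  refine ⟨inf_le_left, ?_, ?_, ?_, ?_⟩
  · exact fun r hr b hb hrb => ⟨hb, h.sat r hr b (lift b hb) hrb.2⟩
  · intro x hx y hy
    obtain ⟨r, hr | hr⟩ := h.uniserial x (lift x hx) y (lift y hy)
    · exact ⟨r, Or.inl ⟨B.sub_mem hx (B.smul_mem r hy), hr⟩⟩
    · exact ⟨r, Or.inr ⟨B.sub_mem hy (B.smul_mem r hx), hr⟩⟩
  · intro s hs b hb
    obtain ⟨x, hx, hbx⟩ := h.div s hs b (lift b hb)
    obtain ⟨b', hb', hxb⟩ := key x hx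
    refine ⟨b', hb', B.sub_mem hb (B.smul_mem s hb'), ?_⟩
    have := C.add_mem hbx (C.smul_mem s hxb)
    rwa [show b - s • x + s • (x - b') = b - s • b' by module] at this
  · intro i hi
    obtain ⟨s, hs, x, hx, hxs⟩ := h.nondiv i hi
    obtain ⟨b, hb, hxb⟩ := key x hx
    refine ⟨s, hs, b, hb, fun b' hb' hC => hxs b' (lift _ hb') ?_⟩
    have := C.add_mem hxb hC.2
    rwa [show x - b + (b - s • b') = x - s • b' by module] at this

theorem RankOneStep.eq_of_smul_sub_mem (h : RankOneStep L j A B) {u₀ : G} (hu₀ : u₀ ∈ B)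
    (hu₀A : u₀ ∉ A) {b : G} {x y : R} (hx : b - x • u₀ ∈ A) (hy : b - y • u₀ ∈ A) : x = y := by
  by_contra hxy
  refine hu₀A (h.sat (x - y) (sub_ne_zero.2 hxy) u₀ hu₀ ?_)
  have := A.sub_mem hy hx
  rwa [show b - y • u₀ - (b - x • u₀) = (x - y) • u₀ by module] at this

/-- The elements of `G` with a nonzero multiple in `N`. -/
def saturation [IsDomain R] (N : Submodule R G) : Submodule R G where
  carrier := {g | ∃ r : R, r ≠ 0 ∧ r • g ∈ N}
  zero_mem' := ⟨1, one_ne_zero, by simp⟩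
  add_mem' := by
    rintro x y ⟨r, hr, hx⟩ ⟨s, hs, hy⟩
    refine ⟨r * s, mul_ne_zero hr hs, ?_⟩
    have := N.add_mem (N.smul_mem s hx) (N.smul_mem r hy)
    rwa [show s • r • x + r • s • y = (r * s) • (x + y) by module] at this
  smul_mem' := by
    rintro c x ⟨r, hr, hx⟩
    refine ⟨r, hr, ?_⟩
    rw [smul_comm]
    exact N.smul_mem c hx

theorem le_saturation [IsDomain R] (N : Submodule R G) : N ≤ saturation N :=
  fun g hg => ⟨1, one_ne_zero, by simpa using hg⟩

theorem saturation_mono [IsDomain R] {N N' : Submodule R G} (h : N ≤ N') :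
    saturation N ≤ saturation N' :=
  fun _ ⟨r, hr, hg⟩ => ⟨r, hr, h hg⟩

theorem mem_saturation_of_smul_mem [IsDomain R] {N : Submodule R G} {r : R} (hr : r ≠ 0) {g : G}
    (h : r • g ∈ saturation N) : g ∈ saturation N := by
  obtain ⟨s, hs, hg⟩ := h
  exact ⟨s * r, mul_ne_zero hs hr, by rwa [mul_smul]⟩

/-- A complement of `B ⧸ A` in `C ⧸ A` exists once some `x₀ ∉ B` in `C` can be divided modulo `A`
whenever it can be divided modulo `B`. -/
theorem exists_complement_of_lift [IsDomain R] (hAB : A ≤ B) (hBC : B ≤ C)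
    (hA : ∀ r : R, r ≠ 0 → ∀ b ∈ B, r • b ∈ A → b ∈ A)
    (hB : ∀ r : R, r ≠ 0 → ∀ c ∈ C, r • c ∈ B → c ∈ B)
    (huni : ∀ x ∈ C, ∀ y ∈ C, ∃ r : R, x - r • y ∈ B ∨ y - r • x ∈ B)
    {x₀ : G} (hx₀ : x₀ ∈ C) (hx₀B : x₀ ∉ B)
    (hlift : ∀ (r : R), ∀ v ∈ C, x₀ - r • v ∈ B → ∃ v' ∈ C, v' - v ∈ B ∧ x₀ - r • v' ∈ A) :
    ∃ D : Submodule R G, D ⊓ B = A ∧ D ⊔ B = C := by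
  have hx₀D : x₀ ∈ C ⊓ saturation (A ⊔ R ∙ x₀) :=
    ⟨hx₀, le_saturation _ (Submodule.mem_sup_right (Submodule.mem_span_singleton_self x₀))⟩
  refine ⟨C ⊓ saturation (A ⊔ R ∙ x₀), le_antisymm ?_ ?_, le_antisymm ?_ ?_⟩
  · rintro d ⟨⟨-, s, hs, hd⟩, hdB⟩
    obtain ⟨a, ha, y, hy, hay⟩ := Submodule.mem_sup.1 hd
    obtain ⟨c, rfl⟩ := Submodule.mem_span_singleton.1 hy
    have hc : c • x₀ ∈ B := by
      have := B.sub_mem (B.smul_mem s hdB) (hAB ha)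
      rwa [← hay, add_sub_cancel_left] at this
    have hc0 : c = 0 := by
      by_contra hc0
      exact hx₀B (hB c hc0 x₀ hx₀ hc)
    rw [hc0, zero_smul, add_zero] at hay
    exact hA s hs d hdB (hay ▸ ha)
  · exact fun a ha => ⟨⟨hBC (hAB ha), le_saturation _ (Submodule.mem_sup_left ha)⟩, hAB ha⟩
  · exact sup_le inf_le_left hBC
  · intro c hc
    -- Modulo `B`, either `c` is a multiple of `x₀` or it divides `x₀`. In the second case the
    -- lifted divisor has a nonzero multiple in `A ⊔ R ∙ x₀`, so it lies in the saturation.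
    obtain ⟨r, hr | hr⟩ := huni c hc x₀ hx₀
    · have := Submodule.add_mem_sup (Submodule.smul_mem _ r hx₀D) hr
      simpa using this
    · obtain ⟨c', hc', hcc, hx⟩ := hlift r c hc hr
      have hr0 : r ≠ 0 := by
        rintro rfl
        exact hx₀B (by simpa using hr)
      have hc'D : c' ∈ C ⊓ saturation (A ⊔ R ∙ x₀) := by
        refine ⟨hc', r, hr0, ?_⟩
        have := Submodule.add_mem_sup (A.neg_mem hx) (Submodule.mem_span_singleton_self (R := R) x₀)
        rwa [show -(x₀ - r • c') + x₀ = r • c' by module] at this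
      have := Submodule.add_mem_sup hc'D (B.neg_mem hcc)
      rwa [show c' + -(c' - c) = c by module] at this

end Steps

/-! ### Congruences in `R` from almost maximality -/

section AlmostMaximal

variable {R : Type u} [CommRing R] [IsDomain R] [ValuationRing R]

/-- Almost maximality of `R_P ⧸ Q R_P` solves systems of congruences in `R` whose ideals are
`R_P`-submodules with a common element outside `Q`. -/
theorem exists_solution_of_isAlmostMaximal (P Q : Ideal R) [P.IsPrime] [Q.IsPrime] (hQP : Q ≤ P)
    (h : IsAlmostMaximal
      (Localization.AtPrime P ⧸ Q.map (algebraMap R (Localization.AtPrime P))))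
    {ι : Type u} [Nonempty ι] (J : ι → Ideal R) (a : ι → R)
    (hJ : ∀ i, ∀ s ∉ P, ∀ x ∈ J i, ∃ y ∈ J i, x = s * y)
    {c : R} (hcQ : c ∉ Q) (hcJ : ∀ i, c ∈ J i)
    (hcompat : ∀ i i', J i ≤ J i' → a i - a i' ∈ J i') :
    ∃ x : R, ∀ i, x - a i ∈ J i := by
  set S := Localization.AtPrime P
  set f : R →+* S := algebraMap R S
  have hf : Function.Injective f := IsLocalization.injective S P.primeCompl_le_nonZeroDivisors
  -- By `hJ` each `J i` is already stable under division by elements outside `P`, so extending it to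
  -- `S` adds nothing.
  have hmap : ∀ i, ∀ z ∈ (J i).map f, ∃ y ∈ J i, z = f y := by
    intro i z hz
    obtain ⟨⟨x, s⟩, hx⟩ := (IsLocalization.mem_map_algebraMap_iff P.primeCompl S).1 hz
    obtain ⟨y, hy, hxy⟩ := hJ i s s.2 x x.2
    refine ⟨y, hy, ?_⟩
    have hs : IsUnit (f s) := IsLocalization.map_units S s
    apply hs.mul_right_cancel
    rw [hx]
    change f x = _
    rw [hxy, map_mul, mul_comm]
  have le_total' : ∀ I I' : Ideal R, I ≤ I' ∨ I' ≤ I :=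
    ((PreValuationRing.iff_ideal_total (R := R)).1 inferInstance).total
  have hQJ : ∀ i, Q ≤ J i := by
    intro i q hq
    rcases ValuationRing.dvd_total c q with hd | hd
    · exact Ideal.mem_of_dvd _ hd (hcJ i)
    · exact absurd (Ideal.mem_of_dvd _ hd hq) hcQ
  have hker : ∀ i, ∀ z : S, Ideal.Quotient.mk (Q.map f) z ∈
      ((J i).map f).map (Ideal.Quotient.mk (Q.map f)) → ∃ y ∈ J i, z = f y := by
    intro i z hz
    apply hmap i z
    rw [← Ideal.mem_comap, Ideal.comap_map_of_surjective _ Ideal.Quotient.mk_surjective,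
      ← RingHom.ker_eq_comap_bot, Ideal.mk_ker, sup_eq_left.2 (Ideal.map_mono (hQJ i))] at hz
    exact hz
  obtain ⟨x, hx⟩ := h ι (fun i => ((J i).map f).map (Ideal.Quotient.mk (Q.map f)))
    (fun i => Ideal.Quotient.mk (Q.map f) (f (a i))) (by
      intro hbot
      have h1 : Ideal.Quotient.mk (Q.map f) (f c) ∈
          ⨅ i, ((J i).map f).map (Ideal.Quotient.mk (Q.map f)) :=
        Submodule.mem_iInf _ |>.2 fun i =>
          Ideal.mem_map_of_mem _ (Ideal.mem_map_of_mem _ (hcJ i))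
      rw [hbot, Ideal.mem_bot, Ideal.Quotient.eq_zero_iff_mem] at h1
      have h2 : c ∈ (Q.map (algebraMap R S)).under R := h1
      rw [IsLocalization.under_map_of_isPrime_disjoint P.primeCompl S ‹_›
        (Set.disjoint_left.2 fun s hs hs' => hs (hQP hs'))] at h2
      exact hcQ h2) (by
      intro s
      rcases s.eq_empty_or_nonempty with rfl | hs
      · exact ⟨0, by simp⟩
      · obtain ⟨i, hi, hmin⟩ := s.exists_minimalFor J hs
        refine ⟨Ideal.Quotient.mk (Q.map f) (f (a i)), fun i' hi' => ?_⟩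
        rw [← map_sub, ← map_sub]
        refine Ideal.mem_map_of_mem _ (Ideal.mem_map_of_mem _ (hcompat i i' ?_))
        exact (le_total' (J i) (J i')).elim id (hmin hi'))
  obtain ⟨z, rfl⟩ := Ideal.Quotient.mk_surjective x
  have hz : ∀ i, ∃ y ∈ J i, z - f (a i) = f y := fun i => hker i _ (by rw [map_sub]; exact hx i)
  obtain ⟨y, -, hy⟩ := hz (Classical.arbitrary ι)
  refine ⟨y + a (Classical.arbitrary ι), fun i => ?_⟩
  obtain ⟨y', hy', hyy⟩ := hz i
  have : f (y + a (Classical.arbitrary ι) - a i) = f y' := by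
    rw [← hyy, map_sub, map_add, ← hy, sub_add_cancel]
  rwa [hf this]

end AlmostMaximal

/-! ### Splitting two consecutive steps -/

section SplittingSteps

variable {R : Type u} [CommRing R] [IsDomain R] [ValuationRing R]
  {G : Type*} [AddCommGroup G] [Module R G] {m : ℕ}
  {L : Fin (m + 1) → Ideal R} {j k l : Fin (m + 1)} {A B C : Submodule R G}

/-- Division of elements of `B` by `u₀` modulo `A`, after multiplication by `t`. -/
theorem RankOneStep.exists_smul_sub_mem (h : RankOneStep L j A B) {t : R} {u₀ : G} (hu₀ : u₀ ∈ B)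
    (ht : ∀ b ∈ B, u₀ - t • b ∉ A) {b : G} (hb : b ∈ B) : ∃ a : R, t • b - a • u₀ ∈ A := by
  obtain ⟨r, hr | hr⟩ := h.uniserial b hb u₀ hu₀
  · refine ⟨t * r, ?_⟩
    have := A.smul_mem t hr
    rwa [show t • (b - r • u₀) = t • b - (t * r) • u₀ by module] at this
  · rcases ValuationRing.dvd_total r t with ⟨e, rfl⟩ | ⟨e, rfl⟩
    · refine ⟨e, ?_⟩
      have := A.smul_mem (-e) hr
      rwa [show (-e) • (u₀ - r • b) = (r * e) • b - e • u₀ by module] at this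
    · refine absurd ?_ (ht (e • b) (B.smul_mem e hb))
      rwa [mul_smul] at hr

/-- Otherwise `s ∣ r`, and dividing `v₀` by `r` would also divide it by `s`. This bounds the
possible divisors of `v₀`. -/
theorem dvd_of_smul_sub_mem {s r : R} {v₀ v : G} (hs : ∀ c ∈ C, v₀ - s • c ∉ B) (hv : v ∈ C)
    (hr : v₀ - r • v ∈ B) : r ∣ s := by
  rcases ValuationRing.dvd_total r s with hd | ⟨e, rfl⟩
  · exact hd
  · exact absurd (by rwa [← mul_smul]) (hs (e • v) (C.smul_mem e hv))

/-- The splitting of two steps with the same index, provided by almost maximality. -/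
theorem RankOneStep.exists_lift_of_isAlmostMaximal {i : Fin m}
    [(L i.castSucc).IsPrime] [(L i.succ).IsPrime] (hL : StrictAnti L)
    (hmax : IsAlmostMaximal (Localization.AtPrime (L i.castSucc) ⧸
        (L i.succ).map (algebraMap R (Localization.AtPrime (L i.castSucc)))))
    (h : RankOneStep L i.castSucc A B) (h' : RankOneStep L i.castSucc B C) :
    ∃ x₀ ∈ C, x₀ ∉ B ∧
      ∀ r : R, ∀ v ∈ C, x₀ - r • v ∈ B → ∃ v' ∈ C, v' - v ∈ B ∧ x₀ - r • v' ∈ A := by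
  obtain ⟨s, hs, v₀, hv₀, hv₀s⟩ := h'.nondiv i rfl
  obtain ⟨t, ht, u₀, hu₀, hu₀t⟩ := h.nondiv i rfl
  have hv₀B : v₀ ∉ B := by simpa using hv₀s 0 C.zero_mem
  have hu₀A : u₀ ∉ A := by simpa using hu₀t 0 B.zero_mem
  have ht0 : t ≠ 0 := by
    rintro rfl
    exact ht (L i.succ).zero_mem
  -- The coordinates `a` of elements `b` of `B ⧸ A`, defined by `t b ≡ a u₀`; multiplying by `t`
  -- keeps them in `R`.
  let I : Ideal R :=
    { carrier := {a | ∃ b ∈ B, t • b - a • u₀ ∈ A}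
      zero_mem' := ⟨0, B.zero_mem, by simp⟩
      add_mem' := by
        rintro x y ⟨b, hb, hx⟩ ⟨c, hc, hy⟩
        refine ⟨b + c, B.add_mem hb hc, ?_⟩
        have := A.add_mem hx hy
        rwa [show t • b - x • u₀ + (t • c - y • u₀) = t • (b + c) - (x + y) • u₀ by module] at this
      smul_mem' := by
        rintro r x ⟨b, hb, hx⟩
        refine ⟨r • b, B.smul_mem r hb, ?_⟩
        have := A.smul_mem r hx
        rwa [show r • (t • b - x • u₀) = t • r • b - (r • x) • u₀ by
          rw [smul_eq_mul]; module] at this }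
  let ι := {r : R // ∃ v ∈ C, v₀ - r • v ∈ B}
  choose v hvC hvB using fun r : ι => r.2
  choose a ha using fun r : ι => h.exists_smul_sub_mem hu₀ hu₀t (hvB r)
  have hr0 : ∀ r : ι, r.1 ≠ 0 := by
    rintro r hr
    apply hv₀B
    simpa [hr] using hvB r
  -- The correction `u ∈ B` must satisfy `u ≡ v₀ - r v` modulo `r B + A` for every divisor `r`. In
  -- coordinates this reads `x ≡ a r` modulo `r I`.
  let J : ι → Ideal R := fun r => Submodule.map (LinearMap.mulLeft R r.1) I
  have memJ : ∀ r x, x ∈ J r ↔ ∃ y ∈ I, r.1 * y = x := fun r x => by simp [J]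
  have compat : ∀ r r' : ι, r'.1 ∣ r.1 → a r - a r' ∈ J r' := by
    rintro r r' ⟨e, he⟩
    have hb : v r' - e • v r ∈ B := by
      apply h'.sat r'.1 (hr0 r') _ (C.sub_mem (hvC r') (C.smul_mem e (hvC r)))
      have := B.sub_mem (hvB r) (hvB r')
      rwa [he, show v₀ - (r'.1 * e) • v r - (v₀ - r'.1 • v r') = r'.1 • (v r' - e • v r) by
        module] at this
    obtain ⟨y, hy⟩ := h.exists_smul_sub_mem hu₀ hu₀t hb
    refine (memJ _ _).2 ⟨y, ⟨_, hb, hy⟩, ?_⟩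
    refine h.eq_of_smul_sub_mem (b := (t * r'.1) • (v r' - e • v r)) hu₀ hu₀A ?_ ?_
    · have := A.smul_mem r'.1 hy
      rwa [show r'.1 • (t • (v r' - e • v r) - y • u₀) =
        (t * r'.1) • (v r' - e • v r) - (r'.1 * y) • u₀ by module] at this
    · have := A.sub_mem (ha r) (ha r')
      rwa [he, show t • (v₀ - (r'.1 * e) • v r) - a r • u₀ - (t • (v₀ - r'.1 • v r') - a r' • u₀) =
        (t * r'.1) • (v r' - e • v r) - (a r - a r') • u₀ by module] at this
  let one : ι := ⟨1, v₀, hv₀, by simp⟩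
  have : Nonempty ι := ⟨one⟩
  -- Since `r ∣ s` and `t`, the coordinate of `u₀`, lies in `I`, the product `s * t` lies in every
  -- `r I`; primality keeps it outside `L i.succ`.
  obtain ⟨x, hx⟩ := exists_solution_of_isAlmostMaximal (L i.castSucc) (L i.succ)
    (hL i.castSucc_lt_succ).le hmax J a (c := s * t) (by
      intro r p hp x hx
      obtain ⟨y, ⟨b, hb, hy⟩, rfl⟩ := (memJ _ _).1 hx
      obtain ⟨b', hb', hbb⟩ := h.div p hp b hb
      obtain ⟨z, hz⟩ := h.exists_smul_sub_mem hu₀ hu₀t hb'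
      refine ⟨r.1 * z, (memJ _ _).2 ⟨z, ⟨b', hb', hz⟩, rfl⟩, ?_⟩
      have hyz : y = p * z := by
        refine h.eq_of_smul_sub_mem (b := t • b) hu₀ hu₀A hy ?_
        have := A.add_mem (A.smul_mem t hbb) (A.smul_mem p hz)
        rwa [show t • (b - p • b') + p • (t • b' - z • u₀) = t • b - (p * z) • u₀ by
          module] at this
      rw [hyz]
      ring) (by
      intro hst
      exact (Ideal.IsPrime.mem_or_mem ‹_› hst).elim hs ht) (by
      intro r
      obtain ⟨e, he⟩ := dvd_of_smul_sub_mem hv₀s (hvC r) (hvB r)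
      refine (memJ _ _).2 ⟨e * t, I.mul_mem_left e ⟨u₀, hu₀, by simp⟩, ?_⟩
      rw [he, mul_assoc]) (by
      intro r r' hle
      rcases ValuationRing.dvd_total r.1 r'.1 with hd | hd
      · rw [← neg_sub]
        exact (J r').neg_mem (hle (compat r' r hd))
      · exact compat r r' hd)
  -- The congruence for `r = 1` forces the solution into `I`, so it is the coordinate of some `u ∈
  -- B`.
  obtain ⟨u, hu, hxu⟩ : x ∈ I := by
    obtain ⟨y, hy, hxy⟩ := (memJ _ _).1 (hx one)
    have h1 : a one ∈ I := ⟨_, hvB one, ha one⟩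
    have : x = y + a one := by
      rw [← sub_eq_iff_eq_add, ← hxy]
      exact one_mul y
    exact this ▸ I.add_mem hy h1
  refine ⟨v₀ - u, C.sub_mem hv₀ (h'.le hu), fun hB => hv₀B ?_, fun r w hw hB => ?_⟩
  · simpa using B.add_mem hB hu
  · have hwB : v₀ - r • w ∈ B := by
      have := B.add_mem hB hu
      rwa [show v₀ - u - r • w + u = v₀ - r • w by module] at this
    let r' : ι := ⟨r, w, hw, hwB⟩
    have hsub : v r' - w ∈ B := by
      apply h'.sat r (hr0 r') _ (C.sub_mem (hvC r') hw)
      have : v₀ - r • w - (v₀ - r • v r') ∈ B := B.sub_mem hwB (hvB r')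
      rwa [show v₀ - r • w - (v₀ - r • v r') = r • (v r' - w) by module] at this
    obtain ⟨y, ⟨b, hb, hy⟩, hxy⟩ := (memJ _ _).1 (hx r')
    change r * y = _ at hxy
    refine ⟨v r' - b, C.sub_mem (hvC r') (h'.le hb), ?_, ?_⟩
    · have := B.sub_mem hsub hb
      rwa [show v r' - w - b = v r' - b - w by module] at this
    · have hmem : v₀ - u - r • (v r' - b) ∈ B := by
        have : v₀ - r • v r' - u + r • b ∈ B := B.add_mem (B.sub_mem (hvB r') hu) (B.smul_mem r hb)
        rwa [show v₀ - r • v r' - u + r • b = v₀ - u - r • (v r' - b) by module] at this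
      apply h.sat t ht0 _ hmem
      have h2 : t • (v₀ - r • v r') - a r' • u₀ ∈ A := ha r'
      have := A.add_mem (A.sub_mem h2 hxu) (A.smul_mem r hy)
      have h3 : x = r * y + a r' := (sub_eq_iff_eq_add.1 hxy.symm)
      rwa [h3, show t • (v₀ - r • v r') - a r' • u₀ - (t • u - (r * y + a r') • u₀) +
        r • (t • b - y • u₀) = t • (v₀ - u - r • (v r' - b)) by module] at this

theorem RankOneStep.exists_complement [∀ k, (L k).IsPrime] (hL : StrictAnti L)
    (hL_last : L (Fin.last m) = ⊥)
    (hmax : ∀ k : Fin m, IsAlmostMaximal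
      (Localization.AtPrime (L k.castSucc) ⧸
        (L k.succ).map (algebraMap R (Localization.AtPrime (L k.castSucc)))))
    (hlk : l ≤ k) (h : RankOneStep L k A B) (h' : RankOneStep L l B C) :
    ∃ D : Submodule R G, D ⊓ B = A ∧ D ⊔ B = C := by
  by_cases hBC : C ≤ B
  · exact ⟨A, inf_eq_left.2 h.le, by rw [le_antisymm hBC h'.le, sup_eq_right.2 h.le]⟩
  suffices H : ∃ x₀ ∈ C, x₀ ∉ B ∧
      ∀ r : R, ∀ v ∈ C, x₀ - r • v ∈ B → ∃ v' ∈ C, v' - v ∈ B ∧ x₀ - r • v' ∈ A by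
    obtain ⟨x₀, hx₀, hx₀B, hlift⟩ := H
    exact exists_complement_of_lift h.le h'.le h.sat h'.sat h'.uniserial hx₀ hx₀B hlift
  -- In the first alternative `B ⧸ A` is divisible by every relevant `r`, so divisions lift at once;
  -- the second needs almost maximality.
  suffices H : (∃ x₀ ∈ C, x₀ ∉ B ∧ ∀ r : R, ∀ v ∈ C, x₀ - r • v ∈ B → r ∉ L k) ∨
      l = k ∧ ∃ i : Fin m, i.castSucc = l by
    rcases H with ⟨x₀, hx₀, hx₀B, hr⟩ | ⟨rfl, i, rfl⟩
    · refine ⟨x₀, hx₀, hx₀B, fun r v hv hB => ?_⟩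
      obtain ⟨u, hu, hA⟩ := h.div r (hr r v hv hB) _ hB
      refine ⟨v + u, C.add_mem hv (h'.le hu), by simpa using hu, ?_⟩
      rwa [show x₀ - r • v - r • u = x₀ - r • (v + u) by module] at hA
    · exact h.exists_lift_of_isAlmostMaximal hL (hmax i) h'
  rcases l.eq_castSucc_or_eq_last with ⟨i, rfl⟩ | rfl
  · rcases hlk.eq_or_lt with rfl | hlt
    · exact Or.inr ⟨rfl, i, rfl⟩
    · left
      obtain ⟨s, hs, v₀, hv₀, hv₀s⟩ := h'.nondiv i rfl
      refine ⟨v₀, hv₀, by simpa using hv₀s 0 C.zero_mem, fun r v hv hB hr => hs ?_⟩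
      exact hL.antitone (Fin.castSucc_lt_iff_succ_le.1 hlt)
        (Ideal.mem_of_dvd _ (dvd_of_smul_sub_mem hv₀s hv hB) hr)
  · left
    obtain rfl : k = Fin.last m := Fin.last_le_iff.1 hlk
    obtain ⟨x₀, hx₀, hx₀B⟩ := Set.not_subset.1 hBC
    refine ⟨x₀, hx₀, hx₀B, fun r v hv hB hr => hx₀B ?_⟩
    rw [hL_last, Ideal.mem_bot] at hr
    simpa [hr] using hB

end SplittingSteps

/-! ### Chains of equal index and sorted series -/

section Chains

variable {R : Type u} [CommRing R] {G : Type*} [AddCommGroup G] [Module R G] {m : ℕ}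
  {L : Fin (m + 1) → Ideal R} {j k l : Fin (m + 1)} {A B C D : Submodule R G}

theorem exists_finite_saturation_eq_top [IsDomain R] (hG : Module.rank R G < ℵ₀) :
    ∃ s : Set G, s.Finite ∧ saturation (Submodule.span R s) = ⊤ := by
  obtain ⟨s, hs, hs'⟩ := exists_maximal_linearIndepOn R (id : G → G)
  refine ⟨s, Cardinal.lt_aleph0_iff_set_finite.1 (lt_of_le_of_lt ?_ hG), ?_⟩
  · exact LinearIndependent.cardinal_le_rank (R := R) hs
  · refine eq_top_iff.2 fun g _ => ?_
    by_cases hg : g ∈ s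
    · exact le_saturation _ (Submodule.subset_span hg)
    · obtain ⟨a, ha, hag⟩ := hs' g hg
      exact ⟨a, ha, by simpa using hag⟩

/-- `B ⧸ A` has a finite filtration all of whose factors are rank-one steps of index `j`. -/
def Chain (L : Fin (m + 1) → Ideal R) (j : Fin (m + 1)) : Submodule R G → Submodule R G → Prop :=
  Relation.ReflTransGen (RankOneStep L j)

theorem Chain.le (h : Chain L j A B) : A ≤ B := by
  induction h with
  | refl => exact le_rfl
  | tail _ hs ih => exact ih.trans hs.le

theorem Chain.sat (h : Chain L j A B) : ∀ r : R, r ≠ 0 → ∀ b ∈ B, r • b ∈ A → b ∈ A := by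
  induction h with
  | refl => exact fun _ _ b hb _ => hb
  | tail hc hs ih =>
    intro r hr b hb hA
    exact ih r hr b (hs.sat r hr b hb (Chain.le hc hA)) hA

/-- Adding `D` to a chain lying above its intersection with `D` gives a chain. -/
theorem Chain.sup (h : Chain L j A B) {X : Submodule R G} (hX : X ⊓ D ≤ A) (hB : B ≤ X) :
    Chain L j (A ⊔ D) (B ⊔ D) := by
  induction h with
  | refl => exact .refl
  | @tail B C hc hs ih =>
    refine (ih (hs.le.trans hB)).tail ?_
    -- Modular law: `C ⊓ D` is already contained in `B`.
    have h1 : C ⊓ (B ⊔ D) = B := by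
      rw [inf_comm, sup_inf_assoc_of_le _ hs.le]
      exact sup_eq_left.2 ((le_inf (inf_le_right.trans hB) inf_le_left).trans (hX.trans (Chain.le hc)))
    have h2 := RankOneStep.sup (C := B ⊔ D) (h1.symm ▸ hs)
    rwa [← sup_assoc, sup_eq_left.2 hs.le] at h2

/-- A series whose `j`-th factor has a chain of index `j`. -/
structure IsSortedSeries (L : Fin (m + 1) → Ideal R) (F : Fin (m + 1 + 1) → Submodule R G)
    (X : Submodule R G) : Prop where
  bot : F 0 = ⊥
  top : F (Fin.last _) = X
  chain : ∀ j : Fin (m + 1), Chain L j (F j.castSucc) (F j.succ)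

theorem IsSortedSeries.monotone {F : Fin (m + 1 + 1) → Submodule R G} {X : Submodule R G}
    (h : IsSortedSeries L F X) : Monotone F :=
  Fin.monotone_iff_le_succ.2 fun j => (h.chain j).le

theorem IsSortedSeries.le {F : Fin (m + 1 + 1) → Submodule R G} {X : Submodule R G}
    (h : IsSortedSeries L F X) (j : Fin (m + 1 + 1)) : F j ≤ X :=
  h.top ▸ h.monotone (Fin.le_last j)

theorem IsSortedSeries.sat {F : Fin (m + 1 + 1) → Submodule R G} {X : Submodule R G}
    (h : IsSortedSeries L F X) (j : Fin (m + 1 + 1)) :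
    ∀ r : R, r ≠ 0 → ∀ b ∈ X, r • b ∈ F j → b ∈ F j := by
  induction j using Fin.reverseInduction with
  | last => exact fun _ _ b hb _ => h.top ▸ hb
  | cast j ih =>
    intro r hr b hb hj
    exact (h.chain j).sat r hr b (ih r hr b hb ((h.chain j).le hj)) hj

end Chains

/-! ### Sorting the factors -/

section Splitting

variable {R : Type u} [CommRing R] [IsDomain R] [ValuationRing R]
  {G : Type*} [AddCommGroup G] [Module R G] {m : ℕ}
  {L : Fin (m + 1) → Ideal R} {j k l : Fin (m + 1)} {A B C D : Submodule R G}

/-- Splitting off the top step of the chain leaves a copy of the factor `C ⧸ B` directly above the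
shorter chain, where induction applies. -/
theorem Chain.exists_complement [∀ k, (L k).IsPrime] (hL : StrictAnti L)
    (hL_last : L (Fin.last m) = ⊥)
    (hmax : ∀ k : Fin m, IsAlmostMaximal
      (Localization.AtPrime (L k.castSucc) ⧸
        (L k.succ).map (algebraMap R (Localization.AtPrime (L k.castSucc)))))
    (hlk : l ≤ k) (h : Chain L k A B) {C : Submodule R G} (h' : RankOneStep L l B C) :
    ∃ D : Submodule R G, D ⊓ B = A ∧ D ⊔ B = C := by
  induction h generalizing C with
  | refl => exact ⟨C, inf_eq_right.2 h'.le, sup_eq_left.2 h'.le⟩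
  | @tail B' B hc hs ih =>
    obtain ⟨E, hE, hE'⟩ := hs.exists_complement hL hL_last hmax hlk h'
    have hEB : RankOneStep L l B' E := hE ▸ RankOneStep.inf (hE'.symm ▸ h')
    obtain ⟨D, hD, hD'⟩ := ih hEB
    have hDE : D ≤ E := hD' ▸ le_sup_left
    refine ⟨D, ?_, ?_⟩
    · rw [← hD, ← hE, ← inf_assoc, inf_eq_left.2 hDE]
    · rw [← hE', ← hD', sup_assoc, sup_eq_right.2 hs.le]

/-- A complement above the `l`-th term exists as soon as all later factors have index at least
`l`. -/
theorem IsSortedSeries.exists_complement [∀ k, (L k).IsPrime] (hL : StrictAnti L)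
    (hL_last : L (Fin.last m) = ⊥)
    (hmax : ∀ k : Fin m, IsAlmostMaximal
      (Localization.AtPrime (L k.castSucc) ⧸
        (L k.succ).map (algebraMap R (Localization.AtPrime (L k.castSucc)))))
    {F : Fin (m + 1 + 1) → Submodule R G} {X Y : Submodule R G}
    (h : IsSortedSeries L F X) (hXY : RankOneStep L l X Y) (j : Fin (m + 1 + 1))
    (hj : l.castSucc ≤ j) :
    ∃ D : Submodule R G, D ⊓ X = F j ∧ D ⊔ X = Y := by
  induction j using Fin.reverseInduction with
  | last => exact ⟨Y, by rw [h.top, inf_eq_right.2 hXY.le], sup_eq_left.2 hXY.le⟩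
  | cast j ih =>
    have hlj : l ≤ j := Fin.castSucc_le_castSucc_iff.1 hj
    obtain ⟨E, hE, hE'⟩ := ih (hj.trans (Fin.castSucc_le_succ j))
    have hs : RankOneStep L l (F j.succ) E := hE ▸ RankOneStep.inf (hE'.symm ▸ hXY)
    obtain ⟨D, hD, hD'⟩ := (h.chain j).exists_complement hL hL_last hmax hlj hs
    have hDE : D ≤ E := hD' ▸ le_sup_left
    refine ⟨D, ?_, ?_⟩
    · rw [← hD, ← hE, ← inf_assoc, inf_eq_left.2 hDE]
    · rw [← hE', ← hD', sup_assoc, sup_eq_right.2 (h.le _)]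

theorem IsSortedSeries.exists_of_step [∀ k, (L k).IsPrime] (hL : StrictAnti L)
    (hL_last : L (Fin.last m) = ⊥)
    (hmax : ∀ k : Fin m, IsAlmostMaximal
      (Localization.AtPrime (L k.castSucc) ⧸
        (L k.succ).map (algebraMap R (Localization.AtPrime (L k.castSucc)))))
    {F : Fin (m + 1 + 1) → Submodule R G} {X Y : Submodule R G}
    (h : IsSortedSeries L F X) (hXY : RankOneStep L l X Y) :
    ∃ F' : Fin (m + 1 + 1) → Submodule R G, IsSortedSeries L F' Y := by
  obtain ⟨D, hD, hD'⟩ := h.exists_complement hL hL_last hmax hXY l.castSucc le_rfl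
  -- `D` meets `X` in the `l`-th term, so adding it to the later terms enlarges only the `l`-th
  -- factor, by one step; the other factors keep their chains.
  refine ⟨fun i => if i ≤ l.castSucc then F i else F i ⊔ D, ?_, ?_, ?_⟩
  · simpa using h.bot
  · rw [if_neg (not_le.2 (Fin.castSucc_lt_last l)), h.top, sup_comm, hD']
  · intro j
    rcases lt_trichotomy j l with hj | rfl | hj
    · rw [if_pos (Fin.castSucc_le_castSucc_iff.2 hj.le),
        if_pos (Fin.succ_le_castSucc_iff.2 hj)]
      exact h.chain j
    · rw [if_pos le_rfl, if_neg (not_le.2 Fin.castSucc_lt_succ)]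
      refine (h.chain j).tail ?_
      have h1 : RankOneStep L j (D ⊓ X) D := RankOneStep.inf (hD'.symm ▸ hXY)
      have h2 : D ⊓ X = D ⊓ F j.succ := by
        refine le_antisymm (le_inf inf_le_left ?_) (inf_le_inf_left _ (h.le _))
        exact hD ▸ (h.chain j).le
      rw [h2] at h1
      have h3 := h1.sup
      rwa [sup_comm] at h3
    · have h1 : l.castSucc < j.castSucc := Fin.castSucc_lt_castSucc_iff.2 hj
      rw [if_neg (not_le.2 h1), if_neg (not_le.2 (h1.trans Fin.castSucc_lt_succ))]
      refine (h.chain j).sup (X := X) ?_ (h.le _)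
      rw [inf_comm, hD]
      exact h.monotone h1.le

/-- Every extension by a torsion-free uniserial module is a rank-one step of some index. -/
theorem exists_rankOneStep (hL_zero : L 0 = IsLocalRing.maximalIdeal R) (hAB : A ≤ B)
    (sat : ∀ r : R, r ≠ 0 → ∀ b ∈ B, r • b ∈ A → b ∈ A)
    (uni : ∀ x ∈ B, ∀ y ∈ B, ∃ r : R, x - r • y ∈ A ∨ y - r • x ∈ A) :
    ∃ j, RankOneStep L j A B := by
  by_contra! hno
  suffices H : ∀ j, ∀ s ∉ L j, ∀ b ∈ B, ∃ b' ∈ B, b - s • b' ∈ A by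
    exact hno (Fin.last m) ⟨hAB, sat, uni, H _, fun k hk => absurd hk (Fin.castSucc_ne_last k)⟩
  intro j
  induction j using Fin.induction with
  | zero =>
    intro s hs b hb
    rw [hL_zero, IsLocalRing.mem_maximalIdeal, mem_nonunits_iff, not_not] at hs
    obtain ⟨s, rfl⟩ := hs
    refine ⟨(↑s⁻¹ : R) • b, B.smul_mem _ hb, ?_⟩
    rw [smul_smul, Units.mul_inv, one_smul, sub_self]
    exact A.zero_mem
  | succ i ih =>
    by_contra! H
    refine hno i.castSucc ⟨hAB, sat, uni, ih, fun k hk => ?_⟩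
    rw [Fin.castSucc_injective _ hk]
    exact H

theorem exists_rankOneStep_saturation (hL_zero : L 0 = IsLocalRing.maximalIdeal R) (s : Set G)
    (g : G) : ∃ j, RankOneStep L j (saturation (Submodule.span R s))
      (saturation (Submodule.span R (insert g s))) := by
  apply exists_rankOneStep hL_zero
  · exact saturation_mono (Submodule.span_mono (Set.subset_insert g s))
  · exact fun r hr b _ hb => mem_saturation_of_smul_mem hr hb
  · rintro x ⟨r, hr, hx⟩ y ⟨t, ht, hy⟩
    obtain ⟨a, x', hx', hx⟩ := Submodule.mem_span_insert.1 hx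
    obtain ⟨c, y', hy', hy⟩ := Submodule.mem_span_insert.1 hy
    -- Modulo the old span, `x` and `y` are `(a / r) g` and `(c / t) g`; the fractions are compared
    -- after clearing denominators.
    wlog hd : a * t ∣ c * r generalizing x y r t a c x' y'
    · obtain ⟨e, he⟩ := this y t ht ‹_› x r hr ‹_› c y' hy' hy a x' hx' hx
        ((ValuationRing.dvd_total _ _).resolve_left hd)
      exact ⟨e, he.symm⟩
    obtain ⟨e, he⟩ := hd
    refine ⟨e, Or.inr ⟨r * t, mul_ne_zero hr ht, ?_⟩⟩
    have h1 : (r * t) • (y - e • x) = r • y' - (t * e) • x' := by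
      calc (r * t) • (y - e • x) = r • (t • y) - (t * e) • (r • x) := by module
        _ = r • y' - (t * e) • x' + (c * r - a * t * e) • g := by rw [hx, hy]; module
        _ = r • y' - (t * e) • x' := by rw [he]; module
    rw [h1]
    exact Submodule.sub_mem _ (Submodule.smul_mem _ _ hy') (Submodule.smul_mem _ _ hx')

theorem exists_isSortedSeries_saturation [Module.IsTorsionFree R G] [∀ k, (L k).IsPrime]
    (hL : StrictAnti L) (hL_zero : L 0 = IsLocalRing.maximalIdeal R)
    (hL_last : L (Fin.last m) = ⊥)
    (hmax : ∀ k : Fin m, IsAlmostMaximal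
      (Localization.AtPrime (L k.castSucc) ⧸
        (L k.succ).map (algebraMap R (Localization.AtPrime (L k.castSucc)))))
    {s : Set G} (hs : s.Finite) :
    ∃ F : Fin (m + 1 + 1) → Submodule R G,
      IsSortedSeries L F (saturation (Submodule.span R s)) := by
  induction s, hs using Set.Finite.induction_on with
  | empty =>
    refine ⟨fun _ => ⊥, rfl, ?_, fun _ => .refl⟩
    refine (eq_bot_iff.2 ?_).symm
    rintro g ⟨r, hr, hg⟩
    rw [Submodule.span_empty, Submodule.mem_bot] at hg
    exact (smul_eq_zero.1 hg).resolve_left hr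
  | insert _ _ ih =>
    obtain ⟨F, hF⟩ := ih
    obtain ⟨j, hj⟩ := exists_rankOneStep_saturation (R := R) (G := G) (L := L) hL_zero _ _
    exact hF.exists_of_step hL hL_last hmax hj

end Splitting

/-! ### Factors as direct sums of ideals -/

section Factors

/-- Two surjections from the same module with the same kernel have isomorphic targets. -/
theorem nonempty_linearEquiv_of_ker_eq {R M N N' : Type*} [CommRing R] [AddCommGroup M]
    [AddCommGroup N] [AddCommGroup N'] [Module R M] [Module R N] [Module R N'] {f : M →ₗ[R] N}
    {g : M →ₗ[R] N'} (hf : Function.Surjective f) (hg : Function.Surjective g)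
    (h : LinearMap.ker f = LinearMap.ker g) : Nonempty (N ≃ₗ[R] N') :=
  ⟨(f.quotKerEquivOfSurjective hf).symm ≪≫ₗ Submodule.quotEquivOfEq _ _ h ≪≫ₗ
    g.quotKerEquivOfSurjective hg⟩

theorem nonempty_quotient_equiv_prod {R G : Type*} [CommRing R] [AddCommGroup G] [Module R G]
    {A B C D : Submodule R G} (hinf : D ⊓ B = A) (hsup : D ⊔ B = C) :
    Nonempty ((C ⧸ A.submoduleOf C) ≃ₗ[R] (D ⧸ A.submoduleOf D) × (B ⧸ A.submoduleOf B)) := by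
  have hD : D ≤ C := hsup ▸ le_sup_left
  have hB : B ≤ C := hsup ▸ le_sup_right
  have hAD : A ≤ D := hinf ▸ inf_le_left
  have hAB : A ≤ B := hinf ▸ inf_le_right
  let ψ : D × B →ₗ[R] C ⧸ A.submoduleOf C :=
    (A.submoduleOf C).mkQ ∘ₗ (Submodule.inclusion hD).coprod (Submodule.inclusion hB)
  let φ : D × B →ₗ[R] (D ⧸ A.submoduleOf D) × (B ⧸ A.submoduleOf B) :=
    (A.submoduleOf D).mkQ.prodMap (A.submoduleOf B).mkQ
  have hψ : Function.Surjective ψ := by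
    refine (Submodule.mkQ_surjective _).comp ?_
    rintro ⟨c, hc⟩
    obtain ⟨d, hd, b, hb, rfl⟩ := Submodule.mem_sup.1 (hsup.symm ▸ hc : c ∈ D ⊔ B)
    exact ⟨(⟨d, hd⟩, ⟨b, hb⟩), rfl⟩
  have hφ : Function.Surjective φ :=
    Function.Surjective.prodMap (Submodule.mkQ_surjective _) (Submodule.mkQ_surjective _)
  refine nonempty_linearEquiv_of_ker_eq hψ hφ ?_
  ext ⟨⟨d, hd⟩, ⟨b, hb⟩⟩
  have h1 : (⟨⟨d, hd⟩, ⟨b, hb⟩⟩ : D × B) ∈ LinearMap.ker ψ ↔ d + b ∈ A := by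
    simp only [ψ, LinearMap.mem_ker, LinearMap.comp_apply, Submodule.mkQ_apply,
      Submodule.Quotient.mk_eq_zero]
    rfl
  have h2 : (⟨⟨d, hd⟩, ⟨b, hb⟩⟩ : D × B) ∈ LinearMap.ker φ ↔ d ∈ A ∧ b ∈ A := by
    simp only [φ, LinearMap.mem_ker, LinearMap.prodMap_apply, Submodule.mkQ_apply,
      Prod.mk_eq_zero, Submodule.Quotient.mk_eq_zero]
    rfl
  rw [h1, h2]
  refine ⟨fun h => ?_, fun h => A.add_mem h.1 h.2⟩
  have hdB : d ∈ B := (B.add_mem_iff_left hb).1 (hAB h)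
  have hdA : d ∈ A := hinf ▸ ⟨hd, hdB⟩
  exact ⟨hdA, (A.add_mem_iff_right hdA).1 h⟩

variable {R : Type u} [CommRing R] [IsDomain R] [ValuationRing R]
  {G : Type*} [AddCommGroup G] [Module R G] {m : ℕ}
  {L : Fin (m + 1) → Ideal R} {j k l : Fin (m + 1)} {A B C D : Submodule R G}

/-- A fixed `t` bounds denominators when `j` is not last. At the last index `L j = 0` and
denominators may be unbounded, so a varying `w ∉ L j`, invertible in the localization, absorbs them.
-/
theorem RankOneStep.exists_coordinate [(L j).IsPrime] (hL_last : L (Fin.last m) = ⊥)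
    (h : RankOneStep L j A B) (hBA : ¬ B ≤ A) :
    ∃ u₀ ∈ B, u₀ ∉ A ∧ ∃ t : R, t ≠ 0 ∧
      ∀ b ∈ B, ∃ a : R, ∃ w ∉ L j, (w * t) • b - a • u₀ ∈ A := by
  rcases j.eq_castSucc_or_eq_last with ⟨i, rfl⟩ | rfl
  · obtain ⟨t, ht, u₀, hu₀, hu₀t⟩ := h.nondiv i rfl
    refine ⟨u₀, hu₀, by simpa using hu₀t 0 B.zero_mem, t, ?_, fun b hb => ?_⟩
    · rintro rfl
      exact ht (L i.succ).zero_mem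
    · obtain ⟨a, ha⟩ := h.exists_smul_sub_mem hu₀ hu₀t hb
      exact ⟨a, 1, (Ideal.ne_top_iff_one _).1 (Ideal.IsPrime.ne_top ‹_›), by rwa [one_mul]⟩
  · obtain ⟨u₀, hu₀, hu₀A⟩ := Set.not_subset.1 hBA
    refine ⟨u₀, hu₀, hu₀A, 1, one_ne_zero, fun b hb => ?_⟩
    obtain ⟨r, hr | hr⟩ := h.uniserial b hb u₀ hu₀
    · exact ⟨r, 1, (Ideal.ne_top_iff_one _).1 (Ideal.IsPrime.ne_top ‹_›), by simpa using hr⟩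
    · refine ⟨1, r, ?_, ?_⟩
      · rw [hL_last, Ideal.mem_bot]
        rintro rfl
        exact hu₀A (by simpa using hr)
      · have := A.neg_mem hr
        rwa [show -(u₀ - r • b) = (r * 1) • b - (1 : R) • u₀ by module] at this

/-- The factor of a rank-one step of index `j` is isomorphic to an ideal of the localization. -/
theorem RankOneStep.exists_ideal [(L j).IsPrime] (hL_last : L (Fin.last m) = ⊥)
    (h : RankOneStep L j A B) :
    ∃ I : Ideal (Localization.AtPrime (L j)), Nonempty ((B ⧸ A.submoduleOf B) ≃ₗ[R] I) := by
  by_cases hBA : B ≤ A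
  · refine ⟨⊥, nonempty_linearEquiv_of_ker_eq (Submodule.mkQ_surjective _)
      (g := (0 : B →ₗ[R] (⊥ : Ideal (Localization.AtPrime (L j))))) (fun y => ⟨0, ?_⟩) ?_⟩
    · exact Subsingleton.elim _ _
    · rw [Submodule.ker_mkQ, LinearMap.ker_zero]
      exact Submodule.submoduleOf_eq_top.2 hBA
  obtain ⟨u₀, hu₀, hu₀A, t, ht, hcoord⟩ := h.exists_coordinate hL_last hBA
  set S := Localization.AtPrime (L j)
  set f : R →+* S := algebraMap R S
  have hf : Function.Injective f :=
    IsLocalization.injective S (L j).primeCompl_le_nonZeroDivisors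
  have hunit : ∀ w ∉ L j, IsUnit (f w) := fun w hw =>
    IsLocalization.map_units S (⟨w, hw⟩ : (L j).primeCompl)
  have hmul : ∀ {v w : R}, v ∉ L j → w ∉ L j → v * w ∉ L j := fun hv hw hvw =>
    (Ideal.IsPrime.mem_or_mem ‹_› hvw).elim hv hw
  -- `z = a / w` is the coordinate of `t b` along `u₀`.
  let Rel : G → S → Prop := fun b z =>
    ∃ a : R, ∃ w ∉ L j, (w * t) • b - a • u₀ ∈ A ∧ f w * z = f a
  have rel_add : ∀ {b c z y}, Rel b z → Rel c y → Rel (b + c) (z + y) := by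
    rintro b c z y ⟨a, w, hw, ha, hz⟩ ⟨a', w', hw', ha', hy⟩
    refine ⟨w' * a + w * a', w * w', hmul hw hw', ?_, ?_⟩
    · have := A.add_mem (A.smul_mem w' ha) (A.smul_mem w ha')
      rwa [show w' • ((w * t) • b - a • u₀) + w • ((w' * t) • c - a' • u₀) =
        (w * w' * t) • (b + c) - (w' * a + w * a') • u₀ by module] at this
    · simp only [map_add, map_mul, ← hz, ← hy]
      ring
  have rel_smul : ∀ {b z} (r : R), Rel b z → Rel (r • b) (r • z) := by
    rintro b z r ⟨a, w, hw, ha, hz⟩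
    refine ⟨r * a, w, hw, ?_, ?_⟩
    · have := A.smul_mem r ha
      rwa [show r • ((w * t) • b - a • u₀) = (w * t) • r • b - (r * a) • u₀ by module] at this
    · rw [Algebra.smul_def, map_mul, ← hz]
      change f w * (f r * z) = _
      ring
  have rel_unique : ∀ {b z y}, Rel b z → Rel b y → z = y := by
    rintro b z y ⟨a, w, hw, ha, hz⟩ ⟨a', w', hw', ha', hy⟩
    have haa : w' * a = w * a' := by
      refine h.eq_of_smul_sub_mem (b := (w * w' * t) • b) hu₀ hu₀A ?_ ?_
      · have := A.smul_mem w' ha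
        rwa [show w' • ((w * t) • b - a • u₀) = (w * w' * t) • b - (w' * a) • u₀ by
          module] at this
      · have := A.smul_mem w ha'
        rwa [show w • ((w' * t) • b - a' • u₀) = (w * w' * t) • b - (w * a') • u₀ by
          module] at this
    apply (hunit _ (hmul hw hw')).mul_left_cancel
    have := congrArg f haa
    rw [map_mul, map_mul, ← hz, ← hy] at this
    rw [map_mul]
    linear_combination this
  have rel_zero : ∀ b ∈ B, Rel b 0 ↔ b ∈ A := by
    refine fun b hb => ⟨?_, fun hbA => ⟨0, 1, ?_, ?_, by simp⟩⟩
    · rintro ⟨a, w, hw, ha, hz⟩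
      rw [mul_zero, eq_comm, map_eq_zero_iff f hf] at hz
      rw [hz, zero_smul, sub_zero] at ha
      refine h.sat _ (mul_ne_zero ?_ ht) b hb ha
      rintro rfl
      exact hw (L j).zero_mem
    · exact (Ideal.ne_top_iff_one _).1 (Ideal.IsPrime.ne_top ‹_›)
    · simpa using A.smul_mem t hbA
  let I : Ideal S :=
    { carrier := {z | ∃ b ∈ B, Rel b z}
      zero_mem' := ⟨0, B.zero_mem, (rel_zero 0 B.zero_mem).2 A.zero_mem⟩
      add_mem' := by
        rintro z y ⟨b, hb, hz⟩ ⟨c, hc, hy⟩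
        exact ⟨b + c, B.add_mem hb hc, rel_add hz hy⟩
      smul_mem' := by
        rintro σ z ⟨b, hb, a, w, hw, ha, hz⟩
        obtain ⟨⟨p, w₀⟩, hp⟩ := IsLocalization.surj (L j).primeCompl σ
        -- Divisibility of the factor by denominators makes the set of coordinates an ideal of `S`,
        -- not just an `R`-submodule.
        obtain ⟨b', hb', hbb⟩ := h.div w₀ w₀.2 b hb
        refine ⟨p • b', B.smul_mem p hb', p * a, w * w₀, hmul hw w₀.2, ?_, ?_⟩
        · have := A.smul_mem p (A.sub_mem ha (A.smul_mem (w * t) hbb))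
          rwa [show p • ((w * t) • b - a • u₀ - (w * t) • (b - w₀.1 • b')) =
            (w * w₀.1 * t) • p • b' - (p * a) • u₀ by module] at this
        · have hp' : σ * f w₀ = f p := hp
          rw [smul_eq_mul, map_mul, map_mul, ← hz, ← hp']
          ring }
  have hex : ∀ b : B, ∃ z, Rel b z := by
    intro b
    obtain ⟨a, w, hw, ha⟩ := hcoord b b.2
    obtain ⟨z, hz⟩ := (hunit w hw).dvd (a := f a)
    exact ⟨z, a, w, hw, ha, hz.symm⟩
  choose φ hφ using hex
  let g : B →ₗ[R] I :=
    { toFun := fun b => ⟨φ b, b, b.2, hφ b⟩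
      map_add' := fun b c => Subtype.ext (rel_unique (hφ (b + c)) (rel_add (hφ b) (hφ c)))
      map_smul' := fun r b => Subtype.ext (rel_unique (hφ (r • b)) (rel_smul r (hφ b))) }
  refine ⟨I, nonempty_linearEquiv_of_ker_eq (Submodule.mkQ_surjective _) (g := g) ?_ ?_⟩
  · rintro ⟨z, b, hb, hz⟩
    exact ⟨⟨b, hb⟩, Subtype.ext (rel_unique (hφ ⟨b, hb⟩) hz)⟩
  · ext b
    have hbA : b ∈ A.submoduleOf B ↔ (b : G) ∈ A := Iff.rfl
    rw [Submodule.ker_mkQ, LinearMap.mem_ker, hbA, ← rel_zero b b.2]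
    refine ⟨fun hb => Subtype.ext (rel_unique (hφ b) hb), fun hb => ?_⟩
    have h0 : φ b = 0 := congrArg Subtype.val hb
    exact h0 ▸ hφ b

theorem Chain.exists_pi_equiv [∀ k, (L k).IsPrime] (hL : StrictAnti L)
    (hL_last : L (Fin.last m) = ⊥)
    (hmax : ∀ k : Fin m, IsAlmostMaximal
      (Localization.AtPrime (L k.castSucc) ⧸
        (L k.succ).map (algebraMap R (Localization.AtPrime (L k.castSucc)))))
    (h : Chain L j A C) :
    ∃ (n : ℕ) (I : Fin n → Ideal (Localization.AtPrime (L j))),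
      Nonempty ((C ⧸ A.submoduleOf C) ≃ₗ[R] ∀ i, I i) := by
  induction h with
  | refl =>
    refine ⟨0, Fin.elim0, nonempty_linearEquiv_of_ker_eq (Submodule.mkQ_surjective _)
      (g := (0 : A →ₗ[R] _)) (fun y => ⟨0, Subsingleton.elim _ _⟩) ?_⟩
    rw [Submodule.ker_mkQ, LinearMap.ker_zero]
    exact Submodule.submoduleOf_self A
  | @tail B C hc hs ih =>
    obtain ⟨n, I, ⟨e⟩⟩ := ih
    obtain ⟨D, hD, hD'⟩ := Chain.exists_complement hL hL_last hmax le_rfl hc hs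
    have hAD : RankOneStep L j A D := hD ▸ RankOneStep.inf (hD'.symm ▸ hs)
    obtain ⟨I', ⟨e'⟩⟩ := hAD.exists_ideal hL_last
    obtain ⟨e''⟩ := nonempty_quotient_equiv_prod hD hD'
    refine ⟨n + 1, Fin.cons I' I, ⟨e'' ≪≫ₗ e'.prodCongr e ≪≫ₗ ?_⟩⟩
    exact Fin.consLinearEquiv R
      (fun i => ((Fin.cons I' I : Fin (n + 1) → Ideal (Localization.AtPrime (L j))) i))

end Factors

/-! ### Purity and conclusion -/

/-- Over a valuation domain a submodule with torsion-free quotient is pure. -/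
theorem isPureIn_of_sat {R : Type*} [CommRing R] [IsDomain R] [ValuationRing R]
    {G : Type*} [AddCommGroup G] [Module R G] {N : Submodule R G}
    (hN : ∀ r : R, r ≠ 0 → ∀ g : G, r • g ∈ N → g ∈ N) : N.IsPureIn := by
  rintro p q r b hb ⟨x, hx⟩
  let X : Submodule R (G ⧸ N) := Submodule.span R (Set.range fun k => N.mkQ (x k))
  have : Module.Finite R X := Module.Finite.span_of_finite R (Set.finite_range _)
  have htors : Submodule.torsion R X = ⊥ := by
    refine eq_bot_iff.2 ?_
    rintro ⟨z, hz⟩ ⟨⟨a, ha⟩, haz⟩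
    obtain ⟨g, rfl⟩ := N.mkQ_surjective z
    have h1 : a • N.mkQ g = 0 := congrArg Subtype.val haz
    rw [← map_smul, Submodule.mkQ_apply, Submodule.Quotient.mk_eq_zero] at h1
    have h2 := hN a (nonZeroDivisors.ne_zero ha) g h1
    refine Subtype.ext ?_
    exact (Submodule.Quotient.mk_eq_zero N).2 h2
  have : Module.Flat R X := Module.Flat.flat_iff_torsion_eq_bot_of_isBezout.2 htors
  have : Module.Free R X := Module.free_of_flat_of_isLocalRing
  -- The images of the solution span a finitely generated torsion-free, hence free, module. It lifts
  -- to `G`, and subtracting the lift moves the solution into `N`.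
  obtain ⟨σ, hσ⟩ := Module.projective_lifting_property N.mkQ X.subtype N.mkQ_surjective
  let z : Fin q → X := fun k => ⟨N.mkQ (x k), Submodule.subset_span ⟨k, rfl⟩⟩
  refine ⟨fun k => x k - σ (z k), fun k => ?_, fun i => ?_⟩
  · rw [← Submodule.Quotient.mk_eq_zero N, ← Submodule.mkQ_apply, map_sub, sub_eq_zero]
    exact (LinearMap.congr_fun hσ (z k)).symm
  · have h1 : ∑ k, r i k • z k = 0 := by
      refine Subtype.ext ?_
      have h2 : N.mkQ (b i) = 0 := (Submodule.Quotient.mk_eq_zero N).2 (hb i)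
      rw [← hx i, map_sum] at h2
      simpa [z] using h2
    have h3 : ∑ k, r i k • σ (z k) = 0 := by
      simpa using congrArg σ h1
    simp only [smul_sub, Finset.sum_sub_distrib, hx i, h3, sub_zero]

end TorsionFreeSeries

theorem mainTheorem6 {R : Type*} [CommRing R] [IsDomain R] [ValuationRing R]
    (m : ℕ) (L : Fin (m + 1) → Ideal R) [∀ k, (L k).IsPrime]
    (hL : StrictAnti L) (hL_zero : L 0 = IsLocalRing.maximalIdeal R)
    (hL_last : L (Fin.last m) = ⊥)
    (hmax : ∀ k : Fin m, IsAlmostMaximal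
      (Localization.AtPrime (L k.castSucc) ⧸
        (L k.succ).map (algebraMap R (Localization.AtPrime (L k.castSucc)))))
    {G : Type*} [AddCommGroup G] [Module R G] [Module.IsTorsionFree R G]
    (hG : Module.rank R G < ℵ₀) :
    ∃ F : Fin (m + 1 + 1) → Submodule R G, IsPureSeries F ∧
      ∀ j : Fin (m + 1), ∃ (n : ℕ) (I : Fin n → Ideal (Localization.AtPrime (L j))),
        Nonempty ((F j.succ ⧸ (F j.castSucc).submoduleOf (F j.succ)) ≃ₗ[R] ⨁ i, I i) := by
  obtain ⟨s, hs, htop⟩ := TorsionFreeSeries.exists_finite_saturation_eq_top hG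
  obtain ⟨F, hF⟩ :=
    TorsionFreeSeries.exists_isSortedSeries_saturation hL hL_zero hL_last hmax hs
  rw [htop] at hF
  refine ⟨F, ⟨hF.bot, hF.top, hF.monotone, fun j => ?_⟩, fun j => ?_⟩
  · exact TorsionFreeSeries.isPureIn_of_sat fun r hr g hg => hF.sat j r hr g trivial hg
  · obtain ⟨n, I, ⟨e⟩⟩ := (hF.chain j).exists_pi_equiv hL hL_last hmax
    exact ⟨n, I, ⟨e ≪≫ₗ (DirectSum.linearEquivFunOnFintype R (Fin n) fun i => I i).symm⟩⟩
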